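/- Let $A\in\mathcal M_{m\times n}(\mathbb Z)$, $B\in\mathcal M_{p\times n}(\mathbb Z)$ and let $r\ge 2$ be an integer. Let \[ \Lambda(A,B,r)=\begin{pmatrix} A & 0 & \cdots & 0\\ 0 & A & \cdots & 0\\ \vdots & & \ddots & \vdots\\ 0 & 0 & \cdots & A\\ B & B & \cdots & B\end{pmatrix} \] ($r$ diagonal blocks $A$) be the generalized Lawrence lifting, and let $\mathcal L_r=\mathrm{Ker}_{\mathbb Z}(\Lambda(A,B,r))\subset\mathbb Z^{rn}$. A Markov basis of an integer matrix $D$ with $N$ columns is a finite set $M\subset\mathrm{Ker}_{\mathbb Z}(D)$ such that any two vectors $w,u\in\mathbb N^N$ with $Dw=Du$ can be joined by a finite sequence of vectors of $\mathbb N^N$, starting at $w$ and ending at $u$, in which consecutive vectors differ by $v$ or $-v$ for some $v\in M$. A Markov basis is minimal if no proper subset of it is a Markov basis. The type of a vector $C\in\mathbb Z^{rn}$ is the number of nonzero rows of $C$ when $C$ is written as an $r\times n$ matrix whose rows are its $r$ consecutive blocks of length $n$. Suppose that $\mathcal L_r$ is non-positive, that is, $\mathcal L_r\cap\mathbb N^{rn}\neq\{0\}$.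 Then there exists a minimal Markov basis $M$ of $\Lambda(A,B,r)$, of minimal cardinality among all minimal Markov bases of $\Lambda(A,B,r)$, such that $M$ contains an element of type $r$. -/

import Mathlib

/-- The lattice `L(A) = Ker_ℤ(A)` of an integer matrix `A`. -/
def kerLattice {ι κ : Type*} [Fintype κ] (A : Matrix ι κ ℤ) : Submodule ℤ (κ → ℤ) :=
  LinearMap.ker A.mulVecLin

/-- A sublattice of `ℤ^κ` is positive if it meets `ℕ^κ` only in the zero vector. -/
def LatticePositive {κ : Type*} (L : Submodule ℤ (κ → ℤ)) : Prop :=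
  (L : Set (κ → ℤ)) ∩ {u | ∀ i, 0 ≤ u i} = {0}

/-- A sublattice of `ℤ^κ` is non-positive if it contains a nonzero vector of `ℕ^κ`. -/
def LatticeNonPositive {κ : Type*} (L : Submodule ℤ (κ → ℤ)) : Prop :=
  ¬ LatticePositive L

/-- One move between points of `ℕ^κ`: add or subtract a vector of `M`. -/
def MarkovStep {κ : Type*} (M : Finset (κ → ℤ)) (w u : κ → ℕ) : Prop :=
  ∃ v ∈ M, (∀ i, (u i : ℤ) = (w i : ℤ) + v i) ∨ (∀ i, (u i : ℤ) = (w i : ℤ) - v i)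

/-- A Markov basis of `A`: a finite subset of `L(A)` such that any two points `w, u` of `ℕ^κ`
with `w - u ∈ L(A)` are joined by a finite sequence of moves of `M` (each used with either sign,
repetitions allowed) all of whose intermediate points lie in `ℕ^κ`. -/
def IsMarkovBasis {ι κ : Type*} [Fintype κ] (A : Matrix ι κ ℤ) (M : Finset (κ → ℤ)) : Prop :=
  (∀ v ∈ M, v ∈ kerLattice A) ∧
  ∀ w u : κ → ℕ, (fun i => (w i : ℤ) - (u i : ℤ)) ∈ kerLattice A →
    Relation.ReflTransGen (MarkovStep M) w u

/-- A Markov basis is minimal if no proper subset of it is a Markov basis. -/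
def IsMinimalMarkovBasis {ι κ : Type*} [Fintype κ] (A : Matrix ι κ ℤ)
    (M : Finset (κ → ℤ)) : Prop :=
  IsMarkovBasis A M ∧ ∀ M' : Finset (κ → ℤ), M' ⊂ M → ¬ IsMarkovBasis A M'

/-- The generalized Lawrence lifting `Λ(A, B, r)`: `r` diagonal blocks `A` on top of a last
block row `(B B ⋯ B)`. The column `(j, c)` is the `c`-th column of the `j`-th block. -/
def lawrenceLifting {m n p : ℕ} (A : Matrix (Fin m) (Fin n) ℤ) (B : Matrix (Fin p) (Fin n) ℤ)
    (r : ℕ) : Matrix ((Fin r × Fin m) ⊕ Fin p) (Fin r × Fin n) ℤ :=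
  Matrix.of fun a jc =>
    match a with
    | Sum.inl ib => if ib.1 = jc.1 then A ib.2 jc.2 else 0
    | Sum.inr b => B b jc.2

/-- The type of `C ∈ ℤ^{rn}`, seen as an `r × n` matrix: the number of its nonzero rows. -/
noncomputable def rowType {r n : ℕ} (C : Fin r × Fin n → ℤ) : ℕ :=
  Set.ncard {i : Fin r | (fun j => C (i, j)) ≠ 0}

/-! Let `e` be a nonnegative lattice vector of largest support and `P` the sublattice of vectors
supported in that of `e`. For any Markov basis `M`, the part `M ∩ P` spans `P`: a path from 0 to a
nonnegative lattice vector stays among such vectors, hence uses moves in `P`, and every element of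
`P` becomes nonnegative after adding a multiple of `e`. So `M ∩ P` has at least `rank P` elements.
Conversely, `P` is spanned by at most `rank P` nonnegative vectors, one with the support of `e`, and
nonnegative moves spanning `P` do all the work of `M ∩ P`. Exchanging them in a Markov basis of
least cardinality preserves minimality. In a Lawrence lifting, the support of `e` meets every row.
-/

section Markov

variable {ι κ : Type*} [Fintype κ]

theorem MarkovStep.symm {κ : Type*} {M : Finset (κ → ℤ)} {w u : κ → ℕ} (h : MarkovStep M w u) :
    MarkovStep M u w := by
  obtain ⟨v, hv, h | h⟩ := h
  · exact ⟨v, hv, Or.inr fun i => by have := h i; omega⟩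
  · exact ⟨v, hv, Or.inl fun i => by have := h i; omega⟩

theorem MarkovStep.reflTransGen_symm {κ : Type*} {M : Finset (κ → ℤ)} {w u : κ → ℕ}
    (h : Relation.ReflTransGen (MarkovStep M) w u) :
    Relation.ReflTransGen (MarkovStep M) u w := by
  induction h with
  | refl => exact .refl
  | tail _ h ih => exact .head h.symm ih

theorem MarkovStep.mono {κ : Type*} {M M' : Finset (κ → ℤ)} (hM : M ⊆ M') {w u : κ → ℕ}
    (h : MarkovStep M w u) : MarkovStep M' w u := by
  obtain ⟨v, hv, h⟩ := h
  exact ⟨v, hM hv, h⟩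

theorem MarkovStep.add_left {κ : Type*} {M : Finset (κ → ℤ)} {w u : κ → ℕ} (b : κ → ℕ)
    (h : MarkovStep M w u) : MarkovStep M (b + w) (b + u) := by
  obtain ⟨v, hv, h | h⟩ := h
  · exact ⟨v, hv, Or.inl fun i => by have := h i; simp only [Pi.add_apply]; push_cast; omega⟩
  · exact ⟨v, hv, Or.inr fun i => by have := h i; simp only [Pi.add_apply]; push_cast; omega⟩

/-! ### Existence of finite Markov bases -/

/-- Every integer matrix with finitely many columns has a finite Markov basis. -/
theorem exists_isMarkovBasis (A : Matrix ι κ ℤ) : ∃ M, IsMarkovBasis A M := by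
  classical
  let S : Set ((κ → ℕ) × (κ → ℕ)) :=
    {x | (fun i => (x.1 i : ℤ) - (x.2 i : ℤ)) ∈ kerLattice A ∧ x.1 ≠ x.2}
  have hS : S.IsPWO := Set.isPWO_of_wellQuasiOrderedLE S
  have hfin : {x | Minimal (· ∈ S) x}.Finite :=
    -- Dickson's lemma for pairs ordered componentwise.
    WellQuasiOrderedLE.finite_of_isAntichain (setOfPred_minimal_antichain _)
  let M : Finset (κ → ℤ) := hfin.toFinset.image fun x i => (x.1 i : ℤ) - (x.2 i : ℤ)
  refine ⟨M, ?_, ?_⟩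
  · intro v hv
    obtain ⟨x, hx, rfl⟩ := Finset.mem_image.1 hv
    exact ((hfin.mem_toFinset.1 hx).1).1
  · suffices H : ∀ (N : ℕ) (w u : κ → ℕ), ∑ i, w i + ∑ i, u i ≤ N →
        (fun i => (w i : ℤ) - (u i : ℤ)) ∈ kerLattice A →
        Relation.ReflTransGen (MarkovStep M) w u from fun w u => H _ w u le_rfl
    intro N
    induction N with
    | zero =>
      intro w u h _
      have hwu : w = u := by
        have h1 : ∑ i, w i = 0 := by omega
        have h2 : ∑ i, u i = 0 := by omega
        funext i
        rw [Finset.sum_eq_zero_iff] at h1 h2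
        rw [h1 i (Finset.mem_univ i), h2 i (Finset.mem_univ i)]
      rw [hwu]
    | succ N ih =>
      intro w u h hL
      by_cases hwu : w = u
      · rw [hwu]
      -- With `w = a + c` and `u = b + d`, one move leads to `b + c`; the smaller pair `(c, d)` is
      -- left to the induction.
      obtain ⟨⟨a, b⟩, ⟨hle₁, hle₂⟩, hmin⟩ := hS.exists_le_minimal (a := (w, u)) ⟨hL, hwu⟩
      have hab : (a, b) ∈ S := hmin.1
      obtain ⟨c, rfl⟩ := exists_add_of_le hle₁
      obtain ⟨d, rfl⟩ := exists_add_of_le hle₂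
      dsimp only at *
      have hpos : 0 < ∑ i, a i + ∑ i, b i := by
        by_contra h0
        have h1 : ∑ i, a i = 0 := by omega
        have h2 : ∑ i, b i = 0 := by omega
        rw [Finset.sum_eq_zero_iff] at h1 h2
        exact hab.2 (funext fun i => by
          dsimp only
          rw [h1 i (Finset.mem_univ i), h2 i (Finset.mem_univ i)])
      simp only [Pi.add_apply, Finset.sum_add_distrib] at h
      have hcd : (fun i => (c i : ℤ) - (d i : ℤ)) ∈ kerLattice A := by
        have := (kerLattice A).sub_mem hL hab.1
        convert this using 1
        funext i
        simp only [Pi.add_apply, Pi.sub_apply]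
        push_cast
        ring
      have hstep : MarkovStep M (a + c) (b + c) := by
        refine ⟨fun i => (a i : ℤ) - (b i : ℤ),
          Finset.mem_image.2 ⟨(a, b), hfin.mem_toFinset.2 hmin, rfl⟩, Or.inr fun i => ?_⟩
        simp only [Pi.add_apply]
        push_cast
        ring
      exact .head hstep ((ih c d (by omega) hcd).lift (b + ·) fun _ _ h => h.add_left b)

/-! ### Lattices spanned by moves; nonnegative generators -/

/-- Differences of points connected by moves from a submodule lie in that submodule. -/
theorem sub_mem_of_reflTransGen {κ : Type*} {M : Finset (κ → ℤ)} (P : Submodule ℤ (κ → ℤ))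
    (hM : ∀ v ∈ M, v ∈ P) {w u : κ → ℕ} (h : Relation.ReflTransGen (MarkovStep M) w u) :
    (fun i => (u i : ℤ) - (w i : ℤ)) ∈ P := by
  induction h with
  | refl =>
    convert P.zero_mem using 1
    funext i
    simp
  | @tail b c _ h ih =>
    obtain ⟨v, hv, h | h⟩ := h
    · convert P.add_mem ih (hM v hv) using 1
      funext i
      simp only [Pi.add_apply, h i]
      ring
    · convert P.sub_mem ih (hM v hv) using 1
      funext i
      simp only [Pi.sub_apply, h i]
      ring

/-- Nonnegative moves connect any two points whose difference lies in the lattice they span. -/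
theorem reflTransGen_of_sub_mem_span {κ : Type*} {B : Finset (κ → ℤ)}
    (hB : ∀ v ∈ B, ∀ i, 0 ≤ v i) {w u : κ → ℕ}
    (h : (fun i => (w i : ℤ) - (u i : ℤ)) ∈ Submodule.span ℤ (B : Set (κ → ℤ))) :
    Relation.ReflTransGen (MarkovStep B) w u := by
  have hcl : ∀ p ∈ AddSubmonoid.closure (B : Set (κ → ℤ)), (∀ i, 0 ≤ p i) ∧
      ∀ a b : κ → ℕ, (∀ i, (b i : ℤ) = a i + p i) → Relation.ReflTransGen (MarkovStep B) a b := by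
    intro p hp
    induction hp using AddSubmonoid.closure_induction with
    | mem v hv => exact ⟨hB v hv, fun a b hab => .single ⟨v, hv, Or.inl hab⟩⟩
    | zero =>
      refine ⟨fun _ => le_rfl, fun a b hab => ?_⟩
      have : a = b := funext fun i => by have := hab i; simp at this; omega
      rw [this]
    | add p q _ _ hp hq =>
      refine ⟨fun i => add_nonneg (hp.1 i) (hq.1 i), fun a b hab => ?_⟩
      have hc : ∀ i, (((a i + (p i).toNat : ℕ)) : ℤ) = a i + p i := fun i => by
        have := hp.1 i
        push_cast
        omega
      refine (hp.2 a (fun i => a i + (p i).toNat) hc).trans (hq.2 _ _ fun i => ?_)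
      rw [hc i, hab i, Pi.add_apply]
      ring
  have hsub : ∀ x ∈ AddSubgroup.closure (B : Set (κ → ℤ)),
      ∃ p ∈ AddSubmonoid.closure (B : Set (κ → ℤ)),
      ∃ q ∈ AddSubmonoid.closure (B : Set (κ → ℤ)), x = p - q := by
    intro x hx
    induction hx using AddSubgroup.closure_induction with
    | mem v hv => exact ⟨v, AddSubmonoid.subset_closure hv, 0, zero_mem _, by simp⟩
    | zero => exact ⟨0, zero_mem _, 0, zero_mem _, by simp⟩
    | add x y _ _ hx hy =>
      obtain ⟨p, hp, q, hq, rfl⟩ := hx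
      obtain ⟨p', hp', q', hq', rfl⟩ := hy
      exact ⟨p + p', add_mem hp hp', q + q', add_mem hq hq', by abel⟩
    | neg x _ hx =>
      obtain ⟨p, hp, q, hq, rfl⟩ := hx
      exact ⟨q, hq, p, hp, by abel⟩
  rw [← Submodule.mem_toAddSubgroup, Submodule.span_int_eq_addSubgroupClosure] at h
  obtain ⟨p, hp, q, hq, hpq⟩ := hsub _ h
  have hq0 := (hcl q hq).1
  have hc : ∀ i, (((w i + (q i).toNat : ℕ)) : ℤ) = w i + q i := fun i => by
    have := hq0 i
    push_cast
    omega
  -- Both points climb to the common point `w + q = u + p`.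
  refine ((hcl q hq).2 w (fun i => w i + (q i).toNat) hc).trans
    (MarkovStep.reflTransGen_symm ((hcl p hp).2 u _ fun i => ?_))
  have := congrFun hpq i
  simp only [Pi.sub_apply] at this
  rw [hc i]
  omega

/-- A lattice with a nonnegative vector of full support is generated by nonnegative vectors, at
most as many as its rank, one of which has full support. -/
theorem exists_nonneg_generators (P : Submodule ℤ (κ → ℤ)) {e : κ → ℤ} (heP : e ∈ P)
    (he : ∀ i, 0 ≤ e i) (he0 : e ≠ 0) (hsupp : ∀ v ∈ P, ∀ i, e i = 0 → v i = 0) :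
    ∃ B : Finset (κ → ℤ), B.card ≤ Module.finrank ℤ P ∧
      Submodule.span ℤ (B : Set (κ → ℤ)) = P ∧ (∀ v ∈ B, ∀ i, 0 ≤ v i) ∧
      ∃ v ∈ B, ∀ i, e i ≠ 0 → v i ≠ 0 := by
  classical
  obtain ⟨k, ⟨b⟩⟩ := P.nonempty_basis_of_pid (Pi.basisFun ℤ κ)
  let e' : P := ⟨e, heP⟩
  have he'0 : e' ≠ 0 := fun h => he0 (congrArg Subtype.val h)
  -- Smith normal form of `ℤe` in `P` gives a basis of `P` containing a vector proportional to `e`;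
  -- `s` will fix its sign.
  obtain ⟨n, bM, bN, f, a, snf⟩ := (Submodule.span ℤ {e'}).smithNormalForm b
  have hn : Nonempty (Fin n) := by
    by_contra hn
    rw [not_nonempty_iff] at hn
    have h := bN.ext_elem (x := ⟨e', Submodule.mem_span_singleton_self e'⟩) (y := 0) isEmptyElim
    exact he'0 (congrArg Subtype.val h)
  obtain ⟨i₀⟩ := hn
  set j := f i₀
  obtain ⟨z, hz⟩ := Submodule.mem_span_singleton.1 (bN i₀).2
  have hza : ∀ i, z * e i = a i₀ * (bM j : κ → ℤ) i := fun i => by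
    have h := congrArg (fun x : P => (x : κ → ℤ) i) (hz.trans (snf i₀))
    simpa using h
  have hN0 : ((bN i₀ : Submodule.span ℤ {e'}) : P) ≠ 0 := fun h =>
    bN.ne_zero i₀ (Subtype.ext h)
  have hz0 : z ≠ 0 := by
    rintro rfl
    exact hN0 (by rw [← hz, zero_smul])
  have ha0 : a i₀ ≠ 0 := by
    intro h
    exact hN0 (by rw [snf i₀, h, zero_smul])
  obtain ⟨s, hs1, hspos⟩ : ∃ s : ℤ, s * s = 1 ∧ 0 < s * (z * a i₀) := by
    rcases lt_or_gt_of_ne (mul_ne_zero hz0 ha0) with h | h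
    · exact ⟨-1, by norm_num, by linarith⟩
    · exact ⟨1, by norm_num, by linarith⟩
  let v : κ → ℤ := s • (bM j : κ → ℤ)
  have hvpos : ∀ i, e i ≠ 0 → 0 < v i := fun i hi => by
    have hei : 0 < e i := lt_of_le_of_ne (he i) (Ne.symm hi)
    have h1 : a i₀ * a i₀ * v i = s * (z * a i₀) * e i := by
      have := hza i
      simp only [v, Pi.smul_apply, smul_eq_mul]
      linear_combination (-(a i₀ * s)) * this
    have h2 : 0 < a i₀ * a i₀ := mul_self_pos.2 ha0
    have h3 : 0 < a i₀ * a i₀ * v i := h1 ▸ mul_pos hspos hei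
    exact pos_of_mul_pos_right h3 h2.le
  have hvP : v ∈ P := P.smul_mem _ (bM j).2
  have hvnn : ∀ i, 0 ≤ v i := fun i => by
    by_cases hi : e i = 0
    · exact (hsupp v hvP i hi).ge
    · exact (hvpos i hi).le
  let N : ℤ := ∑ l, ∑ i, |(bM l : κ → ℤ) i|
  have hNle : ∀ l i, |(bM l : κ → ℤ) i| ≤ N := fun l i =>
    (Finset.single_le_sum (f := fun i => |(bM l : κ → ℤ) i|) (fun _ _ => abs_nonneg _)
      (Finset.mem_univ i)).trans
    (Finset.single_le_sum (f := fun l => ∑ i, |(bM l : κ → ℤ) i|)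
      (fun _ _ => Finset.sum_nonneg fun _ _ => abs_nonneg _) (Finset.mem_univ l))
  -- Since `v ≥ 1` on the support of `e`, adding `N • v` makes the other basis vectors nonnegative
  -- without changing the span.
  let g : Fin k → κ → ℤ := fun l => if l = j then v else (bM l : κ → ℤ) + N • v
  have hgj : g j = v := if_pos rfl
  have hgl : ∀ l, l ≠ j → g l = (bM l : κ → ℤ) + N • v := fun l hl => if_neg hl
  refine ⟨Finset.univ.image g, ?_, ?_, ?_, v, ?_, fun i hi => (hvpos i hi).ne'⟩
  · refine Finset.card_image_le.trans ?_
    rw [Module.finrank_eq_card_basis b, Finset.card_univ]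
  · have hg : ∀ l, g l ∈ Submodule.span ℤ ((Finset.univ.image g : Finset _) : Set (κ → ℤ)) :=
      fun l => Submodule.subset_span
        (Finset.mem_coe.2 (Finset.mem_image_of_mem g (Finset.mem_univ l)))
    apply le_antisymm
    · rw [Submodule.span_le]
      intro x hx
      obtain ⟨l, -, rfl⟩ := Finset.mem_image.1 (Finset.mem_coe.1 hx)
      by_cases hl : l = j
      · rw [hl, hgj]
        exact hvP
      · rw [hgl l hl]
        exact P.add_mem (bM l).2 (P.smul_mem _ hvP)
    · have hb : ∀ l, (bM l : κ → ℤ) ∈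
          Submodule.span ℤ ((Finset.univ.image g : Finset _) : Set (κ → ℤ)) := by
        intro l
        by_cases hl : l = j
        · have h := Submodule.smul_mem _ s (hg j)
          rw [hgj] at h
          simpa only [v, smul_smul, hs1, one_smul, ← hl] using h
        · have h := Submodule.sub_mem _ (hg l) (Submodule.smul_mem _ N (hg j))
          rwa [hgj, hgl l hl, add_sub_cancel_right] at h
      intro x hx
      have h := congrArg Subtype.val (bM.sum_repr ⟨x, hx⟩)
      rw [← show _ = x from h]
      simp only [Submodule.coe_sum, Submodule.coe_smul]
      exact Submodule.sum_mem _ fun l _ => Submodule.smul_mem _ _ (hb l)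
  · intro x hx i
    obtain ⟨l, -, rfl⟩ := Finset.mem_image.1 hx
    by_cases hl : l = j
    · rw [hl, hgj]
      exact hvnn i
    · rw [hgl l hl]
      simp only [Pi.add_apply, Pi.smul_apply, smul_eq_mul]
      by_cases hi : e i = 0
      · rw [hsupp _ (bM l).2 i hi, hsupp v hvP i hi]
        simp
      · have h1 := hvpos i hi
        have h2 := hNle l i
        have h3 := neg_abs_le ((bM l : κ → ℤ) i)
        have h4 := abs_nonneg ((bM l : κ → ℤ) i)
        nlinarith
  · exact Finset.mem_image.2 ⟨j, Finset.mem_univ j, hgj⟩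

/-- Among the nonnegative vectors of a lattice one has a support containing all the others. -/
theorem exists_nonneg_maximal_support (L : Submodule ℤ (κ → ℤ)) :
    ∃ e ∈ L, (∀ i, 0 ≤ e i) ∧ ∀ f ∈ L, (∀ i, 0 ≤ f i) → ∀ i, e i = 0 → f i = 0 := by
  classical
  have key : ∀ i : κ, ∃ g ∈ L, (∀ k, 0 ≤ g k) ∧
      ∀ f ∈ L, (∀ k, 0 ≤ f k) → g i = 0 → f i = 0 := by
    intro i
    by_cases h : ∃ g ∈ L, (∀ k, 0 ≤ g k) ∧ g i ≠ 0
    · obtain ⟨g, hg, hg0, hgi⟩ := h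
      exact ⟨g, hg, hg0, fun _ _ _ h => absurd h hgi⟩
    · refine ⟨0, L.zero_mem, fun _ => le_rfl, fun f hf hf0 _ => ?_⟩
      by_contra hfi
      exact h ⟨f, hf, hf0, hfi⟩
  choose g hg hg0 hgi using key
  refine ⟨∑ i, g i, L.sum_mem fun i _ => hg i, fun k => ?_, fun f hf hf0 i hi => ?_⟩
  · rw [Finset.sum_apply]
    exact Finset.sum_nonneg fun i _ => hg0 i k
  · rw [Finset.sum_apply, Finset.sum_eq_zero_iff_of_nonneg fun l _ => hg0 l i] at hi
    exact hgi i f hf hf0 (hi i (Finset.mem_univ i))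

/-! ### The exchange argument -/

/-- If the kernel lattice contains a nonzero nonnegative vector, then some minimal Markov basis of
smallest cardinality contains a vector whose support contains the supports of all nonnegative
vectors of the lattice. -/
theorem exists_isMinimalMarkovBasis_with_full_support (A : Matrix ι κ ℤ)
    (hnp : LatticeNonPositive (kerLattice A)) :
    ∃ M, IsMinimalMarkovBasis A M ∧ (∀ M', IsMarkovBasis A M' → M.card ≤ M'.card) ∧
      ∃ v ∈ M, ∀ f ∈ kerLattice A, (∀ i, 0 ≤ f i) → ∀ i, f i ≠ 0 → v i ≠ 0 := by
  classical
  obtain ⟨e, heL, he, hmax⟩ := exists_nonneg_maximal_support (kerLattice A)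
  have he0 : e ≠ 0 := by
    rintro rfl
    refine hnp (Set.Subset.antisymm (fun f hf => ?_) ?_)
    · exact funext fun i => hmax f hf.1 hf.2 i rfl
    · rintro _ rfl
      exact ⟨(kerLattice A).zero_mem, fun _ => le_rfl⟩
  let P : Submodule ℤ (κ → ℤ) :=
    { carrier := {v | v ∈ kerLattice A ∧ ∀ i, e i = 0 → v i = 0}
      add_mem' := fun {x y} hx hy => ⟨add_mem hx.1 hy.1, fun i hi => by
        rw [Pi.add_apply, hx.2 i hi, hy.2 i hi, add_zero]⟩
      zero_mem' := ⟨zero_mem _, fun _ _ => rfl⟩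
      smul_mem' := fun c x hx => ⟨Submodule.smul_mem _ c hx.1, fun i hi => by
        rw [Pi.smul_apply, hx.2 i hi, smul_zero]⟩ }
  have heP : e ∈ P := ⟨heL, fun _ h => h⟩
  obtain ⟨B, hBcard, hBspan, hBnn, v, hvB, hv⟩ :=
    exists_nonneg_generators P heP he he0 fun v hv => hv.2
  have hBP : ∀ x ∈ B, x ∈ P := fun x hx => hBspan ▸ Submodule.subset_span (Finset.mem_coe.2 hx)
  obtain ⟨M, hM, hMmin⟩ : ∃ M, IsMarkovBasis A M ∧ ∀ M', IsMarkovBasis A M' → M.card ≤ M'.card := by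
    have hex : ∃ c, ∃ M, IsMarkovBasis A M ∧ M.card = c := by
      obtain ⟨M, hM⟩ := exists_isMarkovBasis A
      exact ⟨_, M, hM, rfl⟩
    obtain ⟨M, hM, hc⟩ := Nat.find_spec hex
    exact ⟨M, hM, fun M' hM' => hc ▸ Nat.find_min' hex ⟨M', hM', rfl⟩⟩
  let G := M.filter (· ∈ P)
  have hnnG : ∀ f ∈ kerLattice A, (∀ i, 0 ≤ f i) →
      f ∈ Submodule.span ℤ (G : Set (κ → ℤ)) := by
    intro f hf hf0
    have hpath := hM.2 0 (fun i => (f i).toNat) (by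
      convert (kerLattice A).neg_mem hf using 1
      funext i
      have := hf0 i
      simp only [Pi.zero_apply, Pi.neg_apply]
      omega)
    have main : ∀ u, Relation.ReflTransGen (MarkovStep M) 0 u →
        Relation.ReflTransGen (MarkovStep G) 0 u := by
      -- Points reachable from 0 are nonnegative kernel vectors, so they vanish wherever `e` does.
      have hsup : ∀ u, Relation.ReflTransGen (MarkovStep M) 0 u → ∀ i, e i = 0 → u i = 0 := by
        intro u hu i hi
        have h1 := sub_mem_of_reflTransGen _ hM.1 hu
        simp only [Pi.zero_apply, Nat.cast_zero, sub_zero] at h1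
        exact_mod_cast hmax _ h1 (fun i => Int.natCast_nonneg _) i hi
      intro u hu
      induction hu with
      | refl => exact .refl
      | @tail b c hb hbc ih =>
        refine ih.tail ?_
        have hb0 := hsup b hb
        have hc0 := hsup c (hb.tail hbc)
        obtain ⟨x, hx, h⟩ := hbc
        refine ⟨x, Finset.mem_filter.2 ⟨hx, hM.1 x hx, fun i hi => ?_⟩, h⟩
        have h1 := hb0 i hi
        have h2 := hc0 i hi
        rcases h with h | h
        · have := h i
          omega
        · have := h i
          omega
    have := sub_mem_of_reflTransGen (Submodule.span ℤ (G : Set (κ → ℤ)))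
      (fun x hx => Submodule.subset_span (Finset.mem_coe.2 hx)) (main _ hpath)
    convert this using 1
    funext i
    have := hf0 i
    simp only [Pi.zero_apply]
    omega
  have hGspan : Submodule.span ℤ (G : Set (κ → ℤ)) = P := by
    apply le_antisymm
    · rw [Submodule.span_le]
      exact fun x hx => (Finset.mem_filter.1 (Finset.mem_coe.1 hx)).2
    · intro x hx
      let N : ℤ := ∑ i, |x i|
      have hNle : ∀ i, |x i| ≤ N := fun i =>
        Finset.single_le_sum (f := fun i => |x i|) (fun _ _ => abs_nonneg _) (Finset.mem_univ i)
      have h1 : x + N • e ∈ Submodule.span ℤ (G : Set (κ → ℤ)) := by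
        refine hnnG _ (add_mem hx.1 (Submodule.smul_mem _ _ heL)) fun i => ?_
        simp only [Pi.add_apply, Pi.smul_apply, smul_eq_mul]
        by_cases hi : e i = 0
        · rw [hx.2 i hi, hi]
          simp
        · have h1 : 0 < e i := lt_of_le_of_ne (he i) (Ne.symm hi)
          have h2 := hNle i
          have h3 := neg_abs_le (x i)
          have h4 := abs_nonneg (x i)
          nlinarith
      have h2 := Submodule.sub_mem _ h1 (Submodule.smul_mem _ N (hnnG e heL he))
      rwa [add_sub_cancel_right] at h2
  have hcard : B.card ≤ G.card := by
    refine hBcard.trans ?_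
    have h := finrank_span_finset_le_card (R := ℤ) G
    rwa [Set.finrank, hGspan] at h
  let M' := M.filter (· ∉ P) ∪ B
  have hM'card : M'.card ≤ M.card := by
    refine (Finset.card_union_le _ _).trans ?_
    rw [← Finset.card_filter_add_card_filter_not (s := M) (· ∈ P)]
    change _ ≤ G.card + _
    omega
  have hM' : IsMarkovBasis A M' := by
    refine ⟨fun x hx => ?_, fun w u hwu => ?_⟩
    · rcases Finset.mem_union.1 hx with hx | hx
      · exact hM.1 x (Finset.mem_filter.1 hx).1
      · exact (hBP x hx).1
    -- Each step of an `M`-path that uses a move in `P` is replaced by a path of `B`-moves.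
    · refine Relation.reflTransGen_closed (fun a b hab => ?_) w u (hM.2 w u hwu)
      obtain ⟨x, hx, h⟩ := hab
      by_cases hxP : x ∈ P
      · refine Relation.ReflTransGen.mono (fun _ _ h => h.mono Finset.subset_union_right) _ _
          (reflTransGen_of_sub_mem_span hBnn ?_)
        rw [hBspan]
        rcases h with h | h
        · convert P.neg_mem hxP using 1
          funext i
          rw [h i, Pi.neg_apply]
          ring
        · convert hxP using 1
          funext i
          rw [h i]
          ring
      · exact .single ⟨x, Finset.mem_union_left _ (Finset.mem_filter.2 ⟨hx, hxP⟩), h⟩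
  have hM'min : ∀ M'', IsMarkovBasis A M'' → M'.card ≤ M''.card := fun M'' h =>
    hM'card.trans (hMmin M'' h)
  refine ⟨M', ⟨hM', fun M'' hlt h => ?_⟩, hM'min, v, Finset.mem_union_right _ hvB, ?_⟩
  · exact absurd (hM'min M'' h) (not_le.2 (Finset.card_lt_card hlt))
  · exact fun f hf hf0 i hi => hv i fun hei => hi (hmax f hf hf0 i hei)

end Markov

/-! ### Lawrence liftings -/

theorem mem_kerLattice_lawrenceLifting {m n p : ℕ} {A : Matrix (Fin m) (Fin n) ℤ}
    {B : Matrix (Fin p) (Fin n) ℤ} {r : ℕ} {C : Fin r × Fin n → ℤ} :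
    C ∈ kerLattice (lawrenceLifting A B r) ↔
      (∀ i b, ∑ c, A b c * C (i, c) = 0) ∧ ∀ b, ∑ i, ∑ c, B b c * C (i, c) = 0 := by
  simp only [kerLattice, LinearMap.mem_ker, Matrix.mulVecLin_apply, funext_iff, Sum.forall,
    Prod.forall, Matrix.mulVec, dotProduct, lawrenceLifting, Matrix.of_apply, Pi.zero_apply,
    Fintype.sum_prod_type, ite_mul, zero_mul]
  refine and_congr (forall_congr' fun i => forall_congr' fun b => ?_) Iff.rfl
  rw [Finset.sum_eq_single i (fun k _ hk => by simp [hk.symm]) (by simp)]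
  simp

theorem mainTheorem6 {m n p : ℕ} (A : Matrix (Fin m) (Fin n) ℤ) (B : Matrix (Fin p) (Fin n) ℤ)
    (r : ℕ) (hr : 2 ≤ r)
    (hnp : LatticeNonPositive (kerLattice (lawrenceLifting A B r))) :
    ∃ M : Finset (Fin r × Fin n → ℤ),
      IsMinimalMarkovBasis (lawrenceLifting A B r) M ∧
      (∀ M' : Finset (Fin r × Fin n → ℤ),
        IsMinimalMarkovBasis (lawrenceLifting A B r) M' → M.card ≤ M'.card) ∧
      ∃ C ∈ M, rowType C = r := by
  obtain ⟨M, hM, hmin, v, hvM, hv⟩ := exists_isMinimalMarkovBasis_with_full_support _ hnp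
  refine ⟨M, hM, fun M' hM' => hmin M' hM'.1, v, hvM, ?_⟩
  obtain ⟨u, huL, hu, k, c, huc⟩ : ∃ u ∈ kerLattice (lawrenceLifting A B r),
      (∀ i, 0 ≤ u i) ∧ ∃ k c, u (k, c) ≠ 0 := by
    by_contra! h
    refine hnp (Set.Subset.antisymm (fun f hf => ?_) ?_)
    · exact funext fun x => h f hf.1 hf.2 x.1 x.2
    · rintro _ rfl
      exact ⟨Submodule.zero_mem _, fun _ => le_rfl⟩
  have huL' := mem_kerLattice_lawrenceLifting.1 huL
  -- Every row of `U` is the sum of the rows of `u`. That sum is killed by both `A` and `B`, and by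
  -- nonnegativity nothing cancels in column `c`.
  let U : Fin r × Fin n → ℤ := fun x => ∑ i, u (i, x.2)
  have hU : U ∈ kerLattice (lawrenceLifting A B r) := by
    refine mem_kerLattice_lawrenceLifting.2 ⟨fun _ b => ?_, fun b => ?_⟩
    · simp only [U, Finset.mul_sum]
      rw [Finset.sum_comm]
      exact Finset.sum_eq_zero fun i _ => huL'.1 i b
    · refine Finset.sum_eq_zero fun _ _ => ?_
      simp only [U, Finset.mul_sum]
      rw [Finset.sum_comm]
      exact huL'.2 b
  have hU0 : ∀ x, 0 ≤ U x := fun x => Finset.sum_nonneg fun i _ => hu _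
  have hUc : ∀ i, U (i, c) ≠ 0 := fun i h =>
    huc ((Finset.sum_eq_zero_iff_of_nonneg fun l _ => hu (l, c)).1 h k (Finset.mem_univ k))
  have huniv : {i : Fin r | (fun j => v (i, j)) ≠ 0} = Set.univ :=
    Set.eq_univ_of_forall fun i h => hv U hU hU0 (i, c) (hUc i) (congrFun h c)
  rw [rowType, huniv, Set.ncard_univ, Nat.card_eq_fintype_card, Fintype.card_fin]
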